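/- Let $D\subset\mathbb C$ be a bounded domain, $0<\alpha<2$ and $1<p<\infty$. For a Lebesgue measurable $\mu:\mathbb C\to[0,\infty)$ put $$A_p(\mu)=\sup_B\left(\frac1{|B|}\int_B\mu\,dV\right)\left(\frac1{|B|}\int_B\mu^{\frac1{1-p}}\,dV\right)^{p-1}\in[0,\infty],$$ where the supremum is over all discs $B\subset\mathbb C$ and $dV$ is Lebesgue measure (with $0^{1/(1-p)}=\infty$ and $0\cdot\infty=0$), and write $\mu\in A_p$ if $A_p(\mu)<\infty$. Let $L^p(D,\mu)$ be the space of measurable $f:D\to\mathbb C$ with $\|f\|_{L^p(D,\mu)}=\left(\int_D|f|^p\mu\,dV\right)^{1/p}<\infty$. Then the operator $$R_\alpha f(z)=\int_D\frac{f(\zeta)}{|\zeta-z|^{\alpha}}\,dV_\zeta$$ is bounded from $L^p(D,\mu)$ into itself for every $\mu\in A_p$, with a bound depending on $\mu$ only through its $A_p$ constant. That is, for every $K\ge 0$ there is a constant $C<\infty$, depending only on $D$, $\alpha$, $p$ and $K$, such that for every $\mu\in A_p$ with $A_p(\mu)\le K$ and every $f\in L^p(D,\mu)$, the integral defining $R_\alpha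 f(z)$ converges absolutely for $\mu\,dV$-almost every $z\in D$, $R_\alpha f\in L^p(D,\mu)$, and $$\|R_\alpha f\|_{L^p(D,\mu)}\le C\,\|f\|_{L^p(D,\mu)}.$$ -/

import Mathlib

open MeasureTheory
open scoped NNReal ENNReal

/-- The Muckenhoupt `A_p` constant of `μ : ℂ → [0, ∞)`, a supremum over all discs `B`, with values
in `[0, ∞]`. Since `1 / (1 - p) < 0` for `p > 1`, the power `μ ^ (1 / (1 - p))` is `∞` where `μ`
vanishes. -/
noncomputable def apConst (p : ℝ) (μ : ℂ → ℝ≥0) : ℝ≥0∞ :=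
  ⨆ (c : ℂ) (r : ℝ) (_ : 0 < r),
    ((volume (Metric.ball c r))⁻¹ * ∫⁻ z in Metric.ball c r, (μ z : ℝ≥0∞)) *
      ((volume (Metric.ball c r))⁻¹ *
        ∫⁻ z in Metric.ball c r, (μ z : ℝ≥0∞) ^ (1 / (1 - p))) ^ (p - 1)

/-- The Muckenhoupt class `A_p` on `ℂ`: Lebesgue measurable weights with finite `A_p` constant. -/
def IsApWeight (p : ℝ) (μ : ℂ → ℝ≥0) : Prop :=
  AEMeasurable μ ∧ apConst p μ < ∞

/-- The measure `μ dV` on `D`; the space `L^p(D, μ)` is the `L^p` space of this measure. -/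
noncomputable def weightedMeasure (D : Set ℂ) (μ : ℂ → ℝ≥0) : Measure ℂ :=
  (volume.restrict D).withDensity fun z => (μ z : ℝ≥0∞)

/-- The integrand `ζ ↦ f(ζ) / |ζ - z|^α`. -/
noncomputable def rieszIntegrand (α : ℝ) (f : ℂ → ℂ) (z ζ : ℂ) : ℂ :=
  f ζ / ((‖ζ - z‖ ^ α : ℝ) : ℂ)

/-- The Riesz-type integral `R_α f(z) = ∫_D f(ζ) / |ζ - z|^α dV_ζ`. -/
noncomputable def rieszIntegral (D : Set ℂ) (α : ℝ) (f : ℂ → ℂ) (z : ℂ) : ℂ :=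
  ∫ ζ in D, rieszIntegrand α f z ζ

/-! On a set of diameter at most `d`, the kernel `|ζ - z|^(-α)` is dominated by a dyadic sum of
indicators of discs about `z`, with coefficient about `r_k^(-α)` at radius `r_k ~ d 2^(-k)`.
Integration over discs of one fixed radius `r` is bounded on `L^p(μ)` by the `A_p` condition alone,
with no maximal function: Hölder against the dual weight, Tonelli, then the `A_p` bound on a disc of
radius `2r` (`lintegral_setLIntegral_ball_rpow_mul_le`). Its operator norm is at most `A_p(μ)^(1/p)`
times the area of a disc of radius `2r`, so the scales sum to a series like `∑ 2^(k(α - 2))`, finite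
because `α < 2` (`lintegral_dyadicPotential_rpow_mul_le`). -/

theorem ENNReal.tsum_mul_rpow_le {p : ℝ} (hp : 1 < p) (c b : ℕ → ℝ≥0∞) (hc : ∑' k, c k ≠ ∞) :
    (∑' k, c k * b k) ^ p ≤ (∑' k, c k) ^ (p - 1) * ∑' k, c k * b k ^ p := by
  have hp0 : 0 < p := by linarith
  have hpq : p.HolderConjugate (p.conjExponent) := Real.HolderConjugate.conjExponent hp
  have hq0 : 0 < p.conjExponent := hpq.symm.pos
  -- Hölder for counting measure, after splitting `c k = c k ^ (1 / p) * c k ^ (1 / q)` with `q`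
  -- conjugate to `p`.
  have key := ENNReal.lintegral_mul_le_Lp_mul_Lq (Measure.count : Measure ℕ) hpq
    (f := fun k => c k ^ (1 / p) * b k) (g := fun k => c k ^ (1 / p.conjExponent))
    (by fun_prop) (by fun_prop)
  simp only [Pi.mul_apply, lintegral_count] at key
  have hck : ∀ k, c k ≠ ∞ := fun k => ENNReal.ne_top_of_tsum_ne_top hc k
  have e1 : ∀ k, c k ^ (1 / p) * b k * c k ^ (1 / p.conjExponent) = c k * b k := by
    intro k
    rw [mul_right_comm, ← ENNReal.rpow_add_of_nonneg _ _ (by positivity) (by positivity)]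
    have : 1 / p + 1 / p.conjExponent = 1 := by
      simpa [one_div] using hpq.inv_add_inv_eq_one
    rw [this, ENNReal.rpow_one]
  have e2 : ∀ k, (c k ^ (1 / p) * b k) ^ p = c k * b k ^ p := by
    intro k
    rw [ENNReal.mul_rpow_of_nonneg _ _ hp0.le, ← ENNReal.rpow_mul, one_div_mul_cancel hp0.ne',
      ENNReal.rpow_one]
  have e3 : ∀ k, (c k ^ (1 / p.conjExponent)) ^ p.conjExponent = c k := by
    intro k
    rw [← ENNReal.rpow_mul, one_div_mul_cancel hq0.ne', ENNReal.rpow_one]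
  simp only [e1, e2, e3] at key
  calc (∑' k, c k * b k) ^ p
      ≤ ((∑' k, c k * b k ^ p) ^ (1 / p) * (∑' k, c k) ^ (1 / p.conjExponent)) ^ p := by gcongr
    _ = (∑' k, c k) ^ (p - 1) * ∑' k, c k * b k ^ p := by
      rw [ENNReal.mul_rpow_of_nonneg _ _ hp0.le, ← ENNReal.rpow_mul, ← ENNReal.rpow_mul,
        one_div_mul_cancel hp0.ne', ENNReal.rpow_one, mul_comm]
      congr 2
      rw [Real.conjExponent]
      field_simp

/-! ### Consequences of the `A_p` condition. -/

theorem apConst_congr {p : ℝ} {μ ν : ℂ → ℝ≥0} (h : μ =ᵐ[volume] ν) :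
    apConst p μ = apConst p ν := by
  have h1 : ∀ B : Set ℂ, ∫⁻ z in B, (μ z : ℝ≥0∞) = ∫⁻ z in B, (ν z : ℝ≥0∞) := fun B =>
    lintegral_congr_ae (ae_restrict_of_ae (h.mono fun z hz => by simp only [hz]))
  have h2 : ∀ B : Set ℂ, ∫⁻ z in B, (μ z : ℝ≥0∞) ^ (1 / (1 - p))
      = ∫⁻ z in B, (ν z : ℝ≥0∞) ^ (1 / (1 - p)) := fun B =>
    lintegral_congr_ae (ae_restrict_of_ae (h.mono fun z hz => by simp only [hz]))
  simp only [apConst, h1, h2]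

theorem setLIntegral_ball_mul_rpow_le_apConst {p : ℝ} (hp : 1 < p) (μ : ℂ → ℝ≥0) (c : ℂ) {r : ℝ}
    (hr : 0 < r) :
    (∫⁻ z in Metric.ball c r, (μ z : ℝ≥0∞)) *
        (∫⁻ z in Metric.ball c r, (μ z : ℝ≥0∞) ^ (1 / (1 - p))) ^ (p - 1) ≤
      apConst p μ * volume (Metric.ball c r) ^ p := by
  have h : ((volume (Metric.ball c r))⁻¹ * ∫⁻ z in Metric.ball c r, (μ z : ℝ≥0∞)) *
      ((volume (Metric.ball c r))⁻¹ *
        ∫⁻ z in Metric.ball c r, (μ z : ℝ≥0∞) ^ (1 / (1 - p))) ^ (p - 1) ≤ apConst p μ := by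
    rw [apConst]
    refine le_iSup_of_le c (le_iSup_of_le r (le_iSup_of_le hr le_rfl))
  set V := volume (Metric.ball c r) with hV
  have hV0 : V ≠ 0 := (Metric.measure_ball_pos volume c hr).ne'
  have hVt : V ≠ ∞ := measure_ball_lt_top.ne
  set I := ∫⁻ z in Metric.ball c r, (μ z : ℝ≥0∞)
  set S := ∫⁻ z in Metric.ball c r, (μ z : ℝ≥0∞) ^ (1 / (1 - p))
  have hp1 : 0 ≤ p - 1 := by linarith
  calc I * S ^ (p - 1) = (V⁻¹ * V) * I * ((V⁻¹ * V) * S) ^ (p - 1) := by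
        rw [ENNReal.inv_mul_cancel hV0 hVt, one_mul, one_mul]
    _ = (V⁻¹ * I * (V⁻¹ * S) ^ (p - 1)) * (V * V ^ (p - 1)) := by
        rw [mul_right_comm V⁻¹ V S, ENNReal.mul_rpow_of_nonneg _ V hp1]; ring
    _ ≤ apConst p μ * (V * V ^ (p - 1)) := by gcongr
    _ = apConst p μ * V ^ p := by
        congr 1
        nth_rewrite 1 [← ENNReal.rpow_one V]
        rw [← ENNReal.rpow_add _ _ hV0 hVt]; congr 1; ring

/-- The convention `0 * ∞ = 0` admits the zero weight, which has to be set apart before dividing by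
`μ`. On a disc where `∫ μ ≠ 0`, finiteness of the `A_p` product forces `μ ^ (1 / (1 - p))` to be
integrable, hence `μ ≠ 0` a.e. there. -/
theorem ae_eq_zero_or_ae_ne_zero_of_apConst_lt_top {p : ℝ} (hp : 1 < p) {μ : ℂ → ℝ≥0}
    (hm : Measurable μ) (h : apConst p μ < ∞) :
    (∀ᵐ z, μ z = 0) ∨ ∀ᵐ z, μ z ≠ 0 := by
  have hcov : ∀ z : ℂ, ∀ n : ℕ, ∃ N : ℕ, n ≤ N ∧ z ∈ Metric.ball (0 : ℂ) (N + 1) := by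
    intro z n
    obtain ⟨k, hk⟩ := exists_nat_gt ‖z‖
    refine ⟨max n k, le_max_left _ _, ?_⟩
    have : (k : ℝ) ≤ (max n k : ℕ) := by exact_mod_cast le_max_right n k
    simp only [Metric.mem_ball, dist_zero_right]
    linarith
  have hm' : Measurable fun z => (μ z : ℝ≥0∞) := hm.coe_nnreal_ennreal
  -- The discs increase to `ℂ`: either `∫ μ` vanishes on arbitrarily large ones, hence on all, or it
  -- is nonzero on every large one.
  by_cases hfreq : ∀ n : ℕ, ∃ N ≥ n, ∫⁻ z in Metric.ball (0 : ℂ) (N + 1), (μ z : ℝ≥0∞) = 0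
  · left
    have hall : ∀ n : ℕ, ∀ᵐ z, z ∈ Metric.ball (0 : ℂ) (n + 1) → μ z = 0 := by
      intro n
      obtain ⟨N, hN, h0⟩ := hfreq n
      rw [lintegral_eq_zero_iff hm', Filter.EventuallyEq,
        ae_restrict_iff' measurableSet_ball] at h0
      filter_upwards [h0] with z hz hzn
      have hnN : (n : ℝ) ≤ N := by exact_mod_cast hN
      simpa using hz (Metric.ball_subset_ball (by linarith) hzn)
    filter_upwards [ae_all_iff.2 hall] with z hz
    obtain ⟨N, -, hN⟩ := hcov z 0
    exact hz N hN
  · right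
    push Not at hfreq
    obtain ⟨n, hn⟩ := hfreq
    have hall : ∀ N : ℕ, ∀ᵐ z, n ≤ N → z ∈ Metric.ball (0 : ℂ) (N + 1) → μ z ≠ 0 := by
      intro N
      by_cases hN : n ≤ N
      swap
      · exact .of_forall fun z h => absurd h hN
      have hr : (0 : ℝ) < N + 1 := by positivity
      have hle := (setLIntegral_ball_mul_rpow_le_apConst hp μ 0 hr).trans_lt
        (ENNReal.mul_lt_top h (ENNReal.rpow_lt_top_of_nonneg (by linarith) measure_ball_lt_top.ne))
      have hS : ∫⁻ z in Metric.ball (0 : ℂ) (N + 1), (μ z : ℝ≥0∞) ^ (1 / (1 - p)) ≠ ∞ := by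
        intro htop
        rw [htop, ENNReal.top_rpow_of_pos (by linarith), ENNReal.mul_top (hn N hN)] at hle
        exact lt_irrefl _ hle
      have := ae_lt_top (hm'.pow_const _) hS
      rw [ae_restrict_iff' measurableSet_ball] at this
      filter_upwards [this] with z hz _ hzN h0
      have := hz hzN
      rw [h0, ENNReal.coe_zero, ENNReal.zero_rpow_of_neg
        (one_div_neg.2 (by linarith))] at this
      exact lt_irrefl _ this
    filter_upwards [ae_all_iff.2 hall] with z hz
    obtain ⟨N, hnN, hN⟩ := hcov z n
    exact hz N hnN hN

/-- Hölder's inequality against an `A_p` weight and its dual weight. -/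
theorem setLIntegral_rpow_le_mul_rpow_dual {p : ℝ} (hp : 1 < p) {μ : ℂ → ℝ≥0} (hm : Measurable μ)
    (h0 : ∀ᵐ z, μ z ≠ 0) {g : ℂ → ℝ≥0∞} (hg : Measurable g) (B : Set ℂ) :
    (∫⁻ z in B, g z) ^ p ≤ (∫⁻ z in B, g z ^ p * μ z) *
      (∫⁻ z in B, (μ z : ℝ≥0∞) ^ (1 / (1 - p))) ^ (p - 1) := by
  have hp0 : 0 < p := by linarith
  have hm' : Measurable fun z => (μ z : ℝ≥0∞) := hm.coe_nnreal_ennreal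
  have hpq : p.HolderConjugate (p.conjExponent) := Real.HolderConjugate.conjExponent hp
  have key := ENNReal.lintegral_mul_le_Lp_mul_Lq (volume.restrict B) hpq
    (f := fun z => g z * (μ z : ℝ≥0∞) ^ (1 / p)) (g := fun z => (μ z : ℝ≥0∞) ^ (-(1 / p)))
    (by fun_prop) (by fun_prop)
  have e1 : ∫⁻ z in B, ((fun z => g z * (μ z : ℝ≥0∞) ^ (1 / p)) *
      fun z => (μ z : ℝ≥0∞) ^ (-(1 / p))) z = ∫⁻ z in B, g z := by
    refine lintegral_congr_ae (ae_restrict_of_ae (h0.mono fun z hz => ?_))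
    simp only [Pi.mul_apply]
    rw [mul_assoc, ← ENNReal.rpow_add _ _ (by simpa using hz) ENNReal.coe_ne_top]
    simp
  have e2 : ∀ z, (g z * (μ z : ℝ≥0∞) ^ (1 / p)) ^ p = g z ^ p * μ z := by
    intro z
    rw [ENNReal.mul_rpow_of_nonneg _ _ hp0.le, ← ENNReal.rpow_mul, one_div_mul_cancel hp0.ne',
      ENNReal.rpow_one]
  have e3 : ∀ z, ((μ z : ℝ≥0∞) ^ (-(1 / p))) ^ p.conjExponent = (μ z : ℝ≥0∞) ^ (1 / (1 - p)) := by
    intro z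
    rw [← ENNReal.rpow_mul]
    congr 1
    have h1 : p - 1 ≠ 0 := by linarith
    have h2 : 1 - p ≠ 0 := by linarith
    rw [Real.conjExponent]
    field_simp
    ring
  simp only [e1, e2, e3] at key
  calc (∫⁻ z in B, g z) ^ p
      ≤ ((∫⁻ z in B, g z ^ p * μ z) ^ (1 / p) *
        (∫⁻ z in B, (μ z : ℝ≥0∞) ^ (1 / (1 - p))) ^ (1 / p.conjExponent)) ^ p := by gcongr
    _ = _ := by
      rw [ENNReal.mul_rpow_of_nonneg _ _ hp0.le, ← ENNReal.rpow_mul, ← ENNReal.rpow_mul,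
        one_div_mul_cancel hp0.ne', ENNReal.rpow_one]
      congr 2
      rw [Real.conjExponent]
      field_simp

/-! ### Integration over discs of a fixed radius. -/

theorem measurable_setLIntegral_ball {g : ℂ → ℝ≥0∞} (hg : Measurable g) (r : ℝ) :
    Measurable fun z => ∫⁻ ζ in Metric.ball z r, g ζ := by
  have hs : MeasurableSet {x : ℂ × ℂ | dist x.2 x.1 < r} :=
    measurableSet_lt (by fun_prop) measurable_const
  have : Measurable fun z => ∫⁻ ζ, {x : ℂ × ℂ | dist x.2 x.1 < r}.indicator
      (fun x => g x.2) (z, ζ) :=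
    ((hg.comp measurable_snd).indicator hs).lintegral_prod_right'
  convert this using 2 with z
  rw [← lintegral_indicator measurableSet_ball]
  rfl

/-- Averages over discs of a fixed radius are bounded on `L^p(μ)` for `A_p` weights. -/
theorem lintegral_setLIntegral_ball_rpow_mul_le {p : ℝ} (hp : 1 < p) {μ : ℂ → ℝ≥0}
    (hm : Measurable μ) (h0 : ∀ᵐ z, μ z ≠ 0) {g : ℂ → ℝ≥0∞} (hg : Measurable g) {r : ℝ}
    (hr : 0 < r) :
    ∫⁻ z, (∫⁻ ζ in Metric.ball z r, g ζ) ^ p * μ z ≤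
      apConst p μ * volume (Metric.ball (0 : ℂ) (2 * r)) ^ p * ∫⁻ ζ, g ζ ^ p * μ ζ := by
  have hm' : Measurable fun z => (μ z : ℝ≥0∞) := hm.coe_nnreal_ennreal
  have hp1 : 0 ≤ p - 1 := by linarith
  set σ : ℂ → ℝ≥0∞ := fun z => (μ z : ℝ≥0∞) ^ (1 / (1 - p)) with hσ
  have hσm : Measurable σ := hm'.pow_const _
  set Φ : ℂ → ℝ≥0∞ := fun z => (∫⁻ ζ in Metric.ball z r, σ ζ) ^ (p - 1) * μ z with hΦ
  have hΦm : Measurable Φ := ((measurable_setLIntegral_ball hσm r).pow_const _).mul hm'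
  set G : ℂ → ℝ≥0∞ := fun ζ => g ζ ^ p * μ ζ with hG
  have hGm : Measurable G := (hg.pow_const _).mul hm'
  set U : Set (ℂ × ℂ) := {x : ℂ × ℂ | dist x.2 x.1 < r} with hU
  have hs : MeasurableSet U := measurableSet_lt (by fun_prop) measurable_const
  -- After Hölder the left side is bounded by the double integral of `F`. Since `|ζ - z| < r` is
  -- symmetric, integrating in `z` first leaves `∫ Φ` over the disc about `ζ`.
  set F : ℂ × ℂ → ℝ≥0∞ := U.indicator fun x => Φ x.1 * G x.2 with hF
  have hFm : Measurable F :=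
    ((hΦm.comp measurable_fst).mul (hGm.comp measurable_snd)).indicator hs
  calc ∫⁻ z, (∫⁻ ζ in Metric.ball z r, g ζ) ^ p * μ z
      ≤ ∫⁻ z, ∫⁻ ζ, F (z, ζ) := by
        refine lintegral_mono fun z => ?_
        have hz : ∫⁻ ζ, F (z, ζ) = Φ z * ∫⁻ ζ in Metric.ball z r, G ζ := by
          rw [← lintegral_const_mul _ hGm, ← lintegral_indicator measurableSet_ball]
          rfl
        rw [hz]
        calc (∫⁻ ζ in Metric.ball z r, g ζ) ^ p * μ z
            ≤ ((∫⁻ ζ in Metric.ball z r, G ζ) * (∫⁻ ζ in Metric.ball z r, σ ζ) ^ (p - 1)) *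
              μ z := by
              gcongr
              exact setLIntegral_rpow_le_mul_rpow_dual hp hm h0 hg _
          _ = _ := by rw [hΦ]; ring
    _ = ∫⁻ ζ, ∫⁻ z, F (z, ζ) := lintegral_lintegral_swap hFm.aemeasurable
    _ ≤ ∫⁻ ζ, apConst p μ * volume (Metric.ball (0 : ℂ) (2 * r)) ^ p * G ζ := by
        refine lintegral_mono fun ζ => ?_
        have hζ : ∫⁻ z, F (z, ζ) = (∫⁻ z in Metric.ball ζ r, Φ z) * G ζ := by
          rw [← lintegral_mul_const _ hΦm, ← lintegral_indicator measurableSet_ball]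
          refine lintegral_congr fun z => ?_
          simp only [hF, hU, Set.indicator, Set.mem_ofPred_eq, Metric.mem_ball, dist_comm]
        rw [hζ]
        gcongr
        -- The doubled disc holds every `B(z, r)` with `z ∈ B(ζ, r)`, so the integrals of `μ` and of
        -- its dual weight are both taken over one disc, where the `A_p` bound applies.
        have hsub : ∀ z ∈ Metric.ball ζ r, Metric.ball z r ⊆ Metric.ball ζ (2 * r) := by
          intro z hz
          refine Metric.ball_subset_ball' ?_
          have := Metric.mem_ball.1 hz
          linarith
        calc ∫⁻ z in Metric.ball ζ r, Φ z
            ≤ ∫⁻ z in Metric.ball ζ r,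
                (∫⁻ ξ in Metric.ball ζ (2 * r), σ ξ) ^ (p - 1) * μ z := by
              refine setLIntegral_mono (by fun_prop) fun z hz => ?_
              simp only [hΦ]
              gcongr
              exact hsub z hz
          _ ≤ (∫⁻ z in Metric.ball ζ (2 * r), (μ z : ℝ≥0∞)) *
                (∫⁻ ξ in Metric.ball ζ (2 * r), σ ξ) ^ (p - 1) := by
              rw [lintegral_const_mul _ hm', mul_comm]
              gcongr
              linarith
          _ ≤ apConst p μ * volume (Metric.ball ζ (2 * r)) ^ p :=
              setLIntegral_ball_mul_rpow_le_apConst hp μ ζ (by linarith)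
          _ = _ := by rw [Measure.addHaar_ball_center]
    _ = _ := lintegral_const_mul _ hGm

/-! ### Dyadic domination of the kernel and summation over scales. -/

/-- A bound for `R_α` on a set of diameter at most `d`, by a sum of integrals over dyadic discs. -/
noncomputable def dyadicPotential (α d : ℝ) (g : ℂ → ℝ≥0∞) (z : ℂ) : ℝ≥0∞ :=
  ∑' k : ℕ, ENNReal.ofReal ((d * (1 / 2) ^ (k + 1)) ^ (-α)) *
    ∫⁻ ζ in Metric.ball z (2 * d * (1 / 2) ^ k), g ζ

theorem measurable_dyadicPotential (α d : ℝ) {g : ℂ → ℝ≥0∞} (hg : Measurable g) :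
    Measurable (dyadicPotential α d g) :=
  Measurable.tsum fun _ => (measurable_setLIntegral_ball hg _).const_mul _

/-- One term suffices: the `k` with `d 2^(-k-1) < |ζ - z| ≤ d 2^(-k)`. The factor 2 in the radius
lets the open disc contain the endpoint. -/
theorem enorm_rieszIntegrand_le {α d : ℝ} (hα : 0 < α) (hd : 0 < d) (f : ℂ → ℂ) {z ζ : ℂ}
    (h : ‖ζ - z‖ ≤ d) :
    ‖rieszIntegrand α f z ζ‖ₑ ≤ ∑' k : ℕ, ENNReal.ofReal ((d * (1 / 2) ^ (k + 1)) ^ (-α)) *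
      (Metric.ball z (2 * d * (1 / 2) ^ k)).indicator (fun ζ => ‖f ζ‖ₑ) ζ := by
  rcases eq_or_ne ζ z with rfl | hne
  -- On the diagonal `0 ^ α = 0`, and division by zero makes the integrand `0`.
  · simp [rieszIntegrand, Real.zero_rpow hα.ne']
  have hpos : 0 < ‖ζ - z‖ := norm_pos_iff.2 (sub_ne_zero.2 hne)
  obtain ⟨k, hk1, hk2⟩ := exists_nat_pow_near_of_lt_one (x := ‖ζ - z‖ / d) (y := 1 / 2)
    (by positivity) ((div_le_one hd).2 h) (by norm_num) (by norm_num)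
  rw [lt_div_iff₀ hd] at hk1
  rw [div_le_iff₀ hd] at hk2
  refine le_trans ?_ (ENNReal.le_tsum k)
  have hmem : ζ ∈ Metric.ball z (2 * d * (1 / 2) ^ k) := by
    rw [Metric.mem_ball, dist_eq_norm]
    have : 0 < (1 / 2 : ℝ) ^ k * d := by positivity
    linarith
  rw [Set.indicator_of_mem hmem, ← ofReal_norm, ← ofReal_norm,
    ← ENNReal.ofReal_mul (by positivity)]
  refine ENNReal.ofReal_le_ofReal ?_
  rw [rieszIntegrand, norm_div, Complex.norm_real, Real.norm_of_nonneg (by positivity),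
    div_eq_mul_inv, ← Real.rpow_neg hpos.le, mul_comm]
  gcongr ?_ * _
  exact Real.rpow_le_rpow_of_nonpos (by positivity) (by linarith) (by linarith)

theorem setLIntegral_enorm_rieszIntegrand_le {α d : ℝ} (hα : 0 < α) (hd : 0 < d) {D : Set ℂ}
    (hD : MeasurableSet D) {f : ℂ → ℂ} (hf : Measurable f) {z : ℂ}
    (h : ∀ ζ ∈ D, ‖ζ - z‖ ≤ d) :
    ∫⁻ ζ in D, ‖rieszIntegrand α f z ζ‖ₑ ≤
      dyadicPotential α d (D.indicator fun ζ => ‖f ζ‖ₑ) z := by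
  have hf' : Measurable fun ζ => ‖f ζ‖ₑ := hf.enorm
  calc ∫⁻ ζ in D, ‖rieszIntegrand α f z ζ‖ₑ
      ≤ ∫⁻ ζ in D, ∑' k : ℕ, ENNReal.ofReal ((d * (1 / 2) ^ (k + 1)) ^ (-α)) *
          (Metric.ball z (2 * d * (1 / 2) ^ k)).indicator (fun ζ => ‖f ζ‖ₑ) ζ :=
        setLIntegral_mono' hD fun ζ hζ => enorm_rieszIntegrand_le hα hd f (h ζ hζ)
    _ = ∑' k : ℕ, ENNReal.ofReal ((d * (1 / 2) ^ (k + 1)) ^ (-α)) *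
          ∫⁻ ζ in D, (Metric.ball z (2 * d * (1 / 2) ^ k)).indicator (fun ζ => ‖f ζ‖ₑ) ζ := by
        rw [lintegral_tsum fun k =>
          ((hf'.indicator measurableSet_ball).const_mul _).aemeasurable]
        exact tsum_congr fun k => lintegral_const_mul _ (hf'.indicator measurableSet_ball)
    _ = _ := by
        refine tsum_congr fun k => ?_
        rw [lintegral_indicator measurableSet_ball, Measure.restrict_restrict measurableSet_ball,
          lintegral_indicator hD, Measure.restrict_restrict hD, Set.inter_comm]

/-- The weights grow like `2^(kα)` and the areas decay like `4^(-k)`, so the series is geometric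
with ratio `2^(α - 2) < 1`. -/
theorem tsum_dyadic_weight_mul_volume_ne_top {α d : ℝ} (hα : α < 2) (hd : 0 < d) :
    ∑' k : ℕ, ENNReal.ofReal ((d * (1 / 2) ^ (k + 1)) ^ (-α)) *
      volume (Metric.ball (0 : ℂ) (2 * (2 * d * (1 / 2) ^ k))) ≠ ∞ := by
  have hterm : ∀ k : ℕ, ENNReal.ofReal ((d * (1 / 2) ^ (k + 1)) ^ (-α)) *
      volume (Metric.ball (0 : ℂ) (2 * (2 * d * (1 / 2) ^ k))) =
      ENNReal.ofReal ((d / 2) ^ (-α) * (4 * d) ^ 2 * Real.pi) *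
        ENNReal.ofReal ((1 / 2) ^ (2 - α)) ^ k := by
    intro k
    have hpi : ((NNReal.pi : ℝ≥0) : ℝ≥0∞) = ENNReal.ofReal Real.pi := by
      rw [← NNReal.coe_real_pi, ENNReal.ofReal_coe_nnreal]
    have hpi0 := Real.pi_pos
    rw [Complex.volume_ball, hpi, ← ENNReal.ofReal_pow (by positivity),
      ← ENNReal.ofReal_mul (by positivity), ← ENNReal.ofReal_mul (by positivity),
      ← ENNReal.ofReal_pow (by positivity), ← ENNReal.ofReal_mul (by positivity)]
    congr 1
    have e1 : d * (1 / 2 : ℝ) ^ (k + 1) = d / 2 * (1 / 2) ^ k := by ring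
    have e2 : ((1 / 2 : ℝ) ^ (2 - α)) ^ k = ((1 / 2 : ℝ) ^ k) ^ (-α) * ((1 / 2) ^ k) ^ 2 := by
      rw [← Real.rpow_natCast (1 / 2) k, ← Real.rpow_natCast ((1 / 2 : ℝ) ^ (2 - α)) k,
        ← Real.rpow_natCast _ 2, ← Real.rpow_mul (by norm_num), ← Real.rpow_mul (by norm_num),
        ← Real.rpow_mul (by norm_num), ← Real.rpow_add (by norm_num)]
      congr 1
      push_cast
      ring
    rw [e1, e2, Real.mul_rpow (by positivity) (by positivity)]
    ring
  simp only [hterm]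
  rw [ENNReal.tsum_mul_left, ENNReal.tsum_geometric]
  refine ENNReal.mul_ne_top ENNReal.ofReal_ne_top (ENNReal.inv_ne_top.2 ?_)
  rw [Ne, tsub_eq_zero_iff_le, not_le, ENNReal.ofReal_lt_one]
  exact Real.rpow_lt_one (by norm_num) (by norm_num) (by linarith)

theorem lintegral_dyadicPotential_rpow_mul_le {p α d : ℝ} (hp : 1 < p) (hα : α < 2) (hd : 0 < d)
    {μ : ℂ → ℝ≥0} (hm : Measurable μ) (h0 : ∀ᵐ z, μ z ≠ 0) {g : ℂ → ℝ≥0∞}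
    (hg : Measurable g) :
    ∫⁻ z, dyadicPotential α d g z ^ p * μ z ≤
      (∑' k : ℕ, ENNReal.ofReal ((d * (1 / 2) ^ (k + 1)) ^ (-α)) *
        volume (Metric.ball (0 : ℂ) (2 * (2 * d * (1 / 2) ^ k)))) ^ p * apConst p μ *
          ∫⁻ ζ, g ζ ^ p * μ ζ := by
  have hm' : Measurable fun z => (μ z : ℝ≥0∞) := hm.coe_nnreal_ennreal
  have hp0 : 0 < p := by linarith
  set r : ℕ → ℝ := fun k => 2 * d * (1 / 2) ^ k
  have hr : ∀ k, 0 < r k := fun k => by positivity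
  set V : ℕ → ℝ≥0∞ := fun k => volume (Metric.ball (0 : ℂ) (2 * r k))
  have hV0 : ∀ k, V k ≠ 0 := fun k =>
    (Metric.measure_ball_pos volume _ (mul_pos two_pos (hr k))).ne'
  have hVt : ∀ k, V k ≠ ∞ := fun k => measure_ball_lt_top.ne
  set w : ℕ → ℝ≥0∞ := fun k => ENNReal.ofReal ((d * (1 / 2) ^ (k + 1)) ^ (-α))
  -- Dividing the disc integral `A k` by the doubled area `V k` gives a bound in `L^p(μ)`
  -- independent of `k` (`hb`). The summable weights `c k` then allow the convexity inequality
  -- `ENNReal.tsum_mul_rpow_le` to do the work of Minkowski's.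
  set c : ℕ → ℝ≥0∞ := fun k => w k * V k
  have hc : ∑' k, c k ≠ ∞ := tsum_dyadic_weight_mul_volume_ne_top hα hd
  have hcp : (∑' k, c k) ^ p = (∑' k, c k) ^ (p - 1) * ∑' k, c k := by
    nth_rewrite 3 [← ENNReal.rpow_one (∑' k, c k)]
    rw [← ENNReal.rpow_add_of_nonneg _ _ (by linarith) zero_le_one, sub_add_cancel]
  set A : ℕ → ℂ → ℝ≥0∞ := fun k z => ∫⁻ ζ in Metric.ball z (r k), g ζ
  have hA : ∀ k, Measurable (A k) := fun k => measurable_setLIntegral_ball hg _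
  set J := ∫⁻ ζ, g ζ ^ p * μ ζ
  have hb : ∀ k, ∫⁻ z, ((V k)⁻¹ * A k z) ^ p * μ z ≤ apConst p μ * J := by
    intro k
    calc ∫⁻ z, ((V k)⁻¹ * A k z) ^ p * μ z = ((V k)⁻¹) ^ p * ∫⁻ z, A k z ^ p * μ z := by
          have hAk : Measurable fun z => A k z ^ p * μ z := ((hA k).pow_const _).mul hm'
          rw [← lintegral_const_mul _ hAk]
          refine lintegral_congr fun z => ?_
          rw [ENNReal.mul_rpow_of_nonneg _ _ hp0.le, mul_assoc]
      _ ≤ ((V k)⁻¹) ^ p * (apConst p μ * V k ^ p * J) := by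
          gcongr
          exact lintegral_setLIntegral_ball_rpow_mul_le hp hm h0 hg (hr k)
      _ = ((V k)⁻¹ * V k) ^ p * (apConst p μ * J) := by
          rw [ENNReal.mul_rpow_of_nonneg _ _ hp0.le]; ring
      _ = apConst p μ * J := by
          rw [ENNReal.inv_mul_cancel (hV0 k) (hVt k), ENNReal.one_rpow, one_mul]
  calc ∫⁻ z, dyadicPotential α d g z ^ p * μ z
      = ∫⁻ z, (∑' k, c k * ((V k)⁻¹ * A k z)) ^ p * μ z := by
        refine lintegral_congr fun z => ?_
        congr 2
        refine tsum_congr fun k => ?_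
        change w k * A k z = w k * V k * ((V k)⁻¹ * A k z)
        rw [mul_assoc, ← mul_assoc (V k), ENNReal.mul_inv_cancel (hV0 k) (hVt k), one_mul]
    _ ≤ ∫⁻ z, ((∑' k, c k) ^ (p - 1) * ∑' k, c k * ((V k)⁻¹ * A k z) ^ p) * μ z := by
        gcongr
        exact ENNReal.tsum_mul_rpow_le hp _ _ hc
    _ = (∑' k, c k) ^ (p - 1) * ∑' k, c k * ∫⁻ z, ((V k)⁻¹ * A k z) ^ p * μ z := by
        have hmk : ∀ k, Measurable fun z => ((V k)⁻¹ * A k z) ^ p * μ z := fun k =>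
          (((hA k).const_mul _).pow_const _).mul hm'
        have : ∀ z, ((∑' k, c k) ^ (p - 1) * ∑' k, c k * ((V k)⁻¹ * A k z) ^ p) * μ z =
            (∑' k, c k) ^ (p - 1) * ∑' k, c k * (((V k)⁻¹ * A k z) ^ p * μ z) := by
          intro z
          rw [mul_assoc, ← ENNReal.tsum_mul_right]
          simp only [mul_assoc]
        simp only [this]
        rw [lintegral_const_mul _ (Measurable.tsum fun k => (hmk k).const_mul _),
          lintegral_tsum fun k => ((hmk k).const_mul _).aemeasurable]
        congr 1
        exact tsum_congr fun k => lintegral_const_mul _ (hmk k)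
    _ ≤ (∑' k, c k) ^ (p - 1) * ∑' k, c k * (apConst p μ * J) := by
        gcongr with k
        exact hb k
    _ = (∑' k, c k) ^ p * apConst p μ * J := by
        rw [ENNReal.tsum_mul_right, hcp]; ring

/-! ### The operator on `L^p(D, μ)`. -/

theorem stronglyMeasurable_rieszIntegral (D : Set ℂ) (α : ℝ) {f : ℂ → ℂ} (hf : Measurable f) :
    StronglyMeasurable (rieszIntegral D α f) := by
  have : Measurable fun x : ℂ × ℂ => rieszIntegrand α f x.1 x.2 := by
    unfold rieszIntegrand
    fun_prop
  exact this.stronglyMeasurable.integral_prod_right'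

theorem rieszIntegrand_ae_eq {D : Set ℂ} {f g : ℂ → ℂ} (h : f =ᵐ[volume.restrict D] g) (α : ℝ)
    (z : ℂ) : rieszIntegrand α f z =ᵐ[volume.restrict D] rieszIntegrand α g z :=
  h.mono fun ζ hζ => by simp only [rieszIntegrand, hζ]

theorem lintegral_weightedMeasure {D : Set ℂ} (hD : MeasurableSet D) {μ : ℂ → ℝ≥0}
    (hm : Measurable μ) {G : ℂ → ℝ≥0∞} (hG : Measurable G) :
    ∫⁻ z, G z ∂(weightedMeasure D μ) = ∫⁻ z, D.indicator G z * μ z := by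
  rw [weightedMeasure, lintegral_withDensity_eq_lintegral_mul _ hm.coe_nnreal_ennreal hG,
    ← lintegral_indicator hD]
  refine lintegral_congr fun z => ?_
  by_cases hz : z ∈ D <;> simp [hz, mul_comm]

theorem lintegral_dyadicPotential_rpow_weightedMeasure_le {p α d : ℝ} (hp : 1 < p) (hα : α < 2)
    (hd : 0 < d) {D : Set ℂ} (hD : MeasurableSet D) {μ : ℂ → ℝ≥0} (hm : Measurable μ)
    (h0 : ∀ᵐ z, μ z ≠ 0) {f : ℂ → ℂ} (hf : Measurable f) :
    ∫⁻ z, dyadicPotential α d (D.indicator fun ζ => ‖f ζ‖ₑ) z ^ p ∂(weightedMeasure D μ) ≤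
      (∑' k : ℕ, ENNReal.ofReal ((d * (1 / 2) ^ (k + 1)) ^ (-α)) *
        volume (Metric.ball (0 : ℂ) (2 * (2 * d * (1 / 2) ^ k)))) ^ p * apConst p μ *
          ∫⁻ ζ, ‖f ζ‖ₑ ^ p ∂(weightedMeasure D μ) := by
  have hg : Measurable (D.indicator fun ζ => ‖f ζ‖ₑ) := hf.enorm.indicator hD
  rw [lintegral_weightedMeasure hD hm ((measurable_dyadicPotential α d hg).pow_const p),
    lintegral_weightedMeasure hD hm (hf.enorm.pow_const p)]
  refine le_trans (lintegral_mono fun z => ?_)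
    ((lintegral_dyadicPotential_rpow_mul_le hp hα hd hm h0 hg).trans_eq ?_)
  · gcongr
    exact Set.indicator_le_self _ _ z
  · congr 1
    refine lintegral_congr fun z => ?_
    by_cases hz : z ∈ D <;> simp [hz, ENNReal.zero_rpow_of_pos (zero_lt_one.trans hp)]

theorem riesz_bounded_of_measurable {p α d : ℝ} (hp : 1 < p) (hα0 : 0 < α) (hα : α < 2)
    (hd : 0 < d) {D : Set ℂ} (hD : MeasurableSet D) (hdD : ∀ z ∈ D, ∀ ζ ∈ D, ‖ζ - z‖ ≤ d)
    {μ : ℂ → ℝ≥0} (hm : Measurable μ) (hμ : apConst p μ < ∞) {f : ℂ → ℂ}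
    (hf : MemLp f (ENNReal.ofReal p) (weightedMeasure D μ)) :
    (∀ᵐ z ∂(weightedMeasure D μ), IntegrableOn (rieszIntegrand α f z) D) ∧
    MemLp (rieszIntegral D α f) (ENNReal.ofReal p) (weightedMeasure D μ) ∧
    eLpNorm (rieszIntegral D α f) (ENNReal.ofReal p) (weightedMeasure D μ) ≤
      ((∑' k : ℕ, ENNReal.ofReal ((d * (1 / 2) ^ (k + 1)) ^ (-α)) *
        volume (Metric.ball (0 : ℂ) (2 * (2 * d * (1 / 2) ^ k)))) * apConst p μ ^ (1 / p)) *
        eLpNorm f (ENNReal.ofReal p) (weightedMeasure D μ) := by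
  have hp0 : 0 < p := by linarith
  rcases ae_eq_zero_or_ae_ne_zero_of_apConst_lt_top hp hm hμ with h0 | h0
  · have : weightedMeasure D μ = 0 := by
      rw [weightedMeasure, withDensity_eq_zero_iff hm.coe_nnreal_ennreal.aemeasurable]
      exact ae_restrict_of_ae (h0.mono fun z hz => by simp [hz])
    simp [this]
  set S : ℝ≥0∞ := ∑' k : ℕ, ENNReal.ofReal ((d * (1 / 2) ^ (k + 1)) ^ (-α)) *
    volume (Metric.ball (0 : ℂ) (2 * (2 * d * (1 / 2) ^ k)))
  have hS : S ≠ ∞ := tsum_dyadic_weight_mul_volume_ne_top hα hd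
  -- As `μ ≠ 0` a.e., `μ dV` and `dV` have the same null sets in `D`. Hence changing `f` on a `μ
  -- dV`-null set leaves `R_α f` unchanged at every point, and `f` may be replaced by a Borel
  -- representative `F`.
  have hac : volume.restrict D ≪ weightedMeasure D μ :=
    withDensity_absolutelyContinuous' hm.coe_nnreal_ennreal.aemeasurable
      (ae_restrict_of_ae (h0.mono fun z hz => by simpa using hz))
  have hac' : weightedMeasure D μ ≪ volume.restrict D := withDensity_absolutelyContinuous _ _
  obtain ⟨F, hF, hfF⟩ : ∃ F : ℂ → ℂ, Measurable F ∧ f =ᵐ[weightedMeasure D μ] F :=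
    ⟨hf.1.mk f, hf.1.stronglyMeasurable_mk.measurable, hf.1.ae_eq_mk⟩
  have hfF' : f =ᵐ[volume.restrict D] F := hac.ae_le hfF
  have hR : rieszIntegral D α f = rieszIntegral D α F :=
    funext fun z => integral_congr_ae (rieszIntegrand_ae_eq hfF' α z)
  have hFL : MemLp F (ENNReal.ofReal p) (weightedMeasure D μ) := (memLp_congr_ae hfF).1 hf
  set T := dyadicPotential α d (D.indicator fun ζ => ‖F ζ‖ₑ)
  have hTm : Measurable T := measurable_dyadicPotential α d (hF.enorm.indicator hD)
  have hmemD : ∀ᵐ z ∂(weightedMeasure D μ), z ∈ D := hac'.ae_le (ae_restrict_mem hD)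
  have hle : ∀ᵐ z ∂(weightedMeasure D μ),
      ∫⁻ ζ in D, ‖rieszIntegrand α F z ζ‖ₑ ≤ T z := by
    filter_upwards [hmemD] with z hz
    exact setLIntegral_enorm_rieszIntegrand_le hα0 hd hD hF (hdD z hz)
  have hp_ne0 : ENNReal.ofReal p ≠ 0 := by simpa using hp0
  have heL : ∀ h : ℂ → ℂ, eLpNorm h (ENNReal.ofReal p) (weightedMeasure D μ) =
      (∫⁻ z, ‖h z‖ₑ ^ p ∂(weightedMeasure D μ)) ^ (1 / p) := fun h => by
    rw [eLpNorm_eq_lintegral_rpow_enorm_toReal hp_ne0 ENNReal.ofReal_ne_top,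
      ENNReal.toReal_ofReal hp0.le]
  have hT : ∫⁻ z, T z ^ p ∂(weightedMeasure D μ) ≤
      S ^ p * apConst p μ * ∫⁻ ζ, ‖F ζ‖ₑ ^ p ∂(weightedMeasure D μ) :=
    lintegral_dyadicPotential_rpow_weightedMeasure_le hp hα hd hD hm h0 hF
  have hFfin : ∫⁻ ζ, ‖F ζ‖ₑ ^ p ∂(weightedMeasure D μ) ≠ ∞ := by
    have := hFL.2
    rw [heL] at this
    exact ((ENNReal.rpow_lt_top_iff_of_pos (by positivity)).1 this).ne
  have hTfin : ∫⁻ z, T z ^ p ∂(weightedMeasure D μ) ≠ ∞ :=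
    (hT.trans_lt (ENNReal.mul_lt_top (ENNReal.mul_lt_top
      (ENNReal.rpow_lt_top_of_nonneg hp0.le hS) hμ) hFfin.lt_top)).ne
  have hbound : eLpNorm (rieszIntegral D α f) (ENNReal.ofReal p) (weightedMeasure D μ) ≤
      (S * apConst p μ ^ (1 / p)) * eLpNorm f (ENNReal.ofReal p) (weightedMeasure D μ) := by
    rw [eLpNorm_congr_ae hfF, hR, heL, heL]
    calc (∫⁻ z, ‖rieszIntegral D α F z‖ₑ ^ p ∂(weightedMeasure D μ)) ^ (1 / p)
        ≤ (S ^ p * apConst p μ * ∫⁻ ζ, ‖F ζ‖ₑ ^ p ∂(weightedMeasure D μ)) ^ (1 / p) := by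
          gcongr
          refine le_trans (lintegral_mono_ae ?_) hT
          filter_upwards [hle] with z hz
          gcongr
          exact (enorm_integral_le_lintegral_enorm _).trans hz
      _ = _ := by
          rw [ENNReal.mul_rpow_of_nonneg _ _ (by positivity),
            ENNReal.mul_rpow_of_nonneg _ _ (by positivity), ← ENNReal.rpow_mul,
            mul_one_div_cancel hp0.ne', ENNReal.rpow_one]
  refine ⟨?_, ⟨?_, ?_⟩, hbound⟩
  -- Absolute convergence comes from the norm bound: `T ^ p` is integrable, so the majorant `T z` is
  -- finite a.e.
  · filter_upwards [hle, ae_lt_top (hTm.pow_const p) hTfin] with z hz hzt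
    have hFi : IntegrableOn (rieszIntegrand α F z) D := by
      refine ⟨?_, hz.trans_lt ((ENNReal.rpow_lt_top_iff_of_pos hp0).1 hzt)⟩
      have : Measurable (rieszIntegrand α F z) := by
        unfold rieszIntegrand
        fun_prop
      exact this.aestronglyMeasurable
    exact hFi.congr (rieszIntegrand_ae_eq hfF' α z).symm
  · rw [hR]
    exact (stronglyMeasurable_rieszIntegral D α hF).aestronglyMeasurable
  · exact hbound.trans_lt (ENNReal.mul_lt_top (ENNReal.mul_lt_top hS.lt_top
      (ENNReal.rpow_lt_top_of_nonneg (by positivity) hμ.ne)) hf.2)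

theorem proposition2p2 (D : Set ℂ) (hDo : IsOpen D) (hDc : IsConnected D)
    (hDb : Bornology.IsBounded D) (α : ℝ) (hα0 : 0 < α) (hα2 : α < 2) (p : ℝ) (hp : 1 < p)
    (K : ℝ≥0) :
    ∃ C : ℝ≥0, ∀ μ : ℂ → ℝ≥0, IsApWeight p μ → apConst p μ ≤ K →
      ∀ f : ℂ → ℂ, MemLp f (ENNReal.ofReal p) (weightedMeasure D μ) →
        (∀ᵐ z ∂(weightedMeasure D μ), IntegrableOn (rieszIntegrand α f z) D) ∧
        MemLp (rieszIntegral D α f) (ENNReal.ofReal p) (weightedMeasure D μ) ∧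
        eLpNorm (rieszIntegral D α f) (ENNReal.ofReal p) (weightedMeasure D μ) ≤
          C * eLpNorm f (ENNReal.ofReal p) (weightedMeasure D μ) := by
  obtain ⟨d, hd, hdD⟩ := hDb.subset_ball_lt 0 0
  have hdist : ∀ z ∈ D, ∀ ζ ∈ D, ‖ζ - z‖ ≤ 2 * d := fun z hz ζ hζ => by
    have h1 := mem_ball_zero_iff.1 (hdD hz)
    have h2 := mem_ball_zero_iff.1 (hdD hζ)
    linarith [norm_sub_le ζ z]
  have hd2 : 0 < 2 * d := by linarith
  have hS := tsum_dyadic_weight_mul_volume_ne_top hα2 hd2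
  have hK : (K : ℝ≥0∞) ^ (1 / p) ≠ ∞ :=
    ENNReal.rpow_ne_top_of_nonneg (by positivity) ENNReal.coe_ne_top
  -- The constant is the dyadic sum at scale `2 * d`, a bound for the diameter of `D`, times `K ^ (1
  -- / p)`. Both factors are finite, so `toNNReal` loses nothing.
  refine ⟨((∑' k : ℕ, ENNReal.ofReal ((2 * d * (1 / 2) ^ (k + 1)) ^ (-α)) *
    volume (Metric.ball (0 : ℂ) (2 * (2 * (2 * d) * (1 / 2) ^ k)))) *
      (K : ℝ≥0∞) ^ (1 / p)).toNNReal, fun μ hμ hμK f hf => ?_⟩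
  -- A Borel representative of `μ` has the same `A_p` constant and the same weighted measure.
  have hae : μ =ᵐ[volume] hμ.1.mk μ := hμ.1.ae_eq_mk
  have hw : weightedMeasure D μ = weightedMeasure D (hμ.1.mk μ) :=
    withDensity_congr_ae (ae_restrict_of_ae (hae.mono fun z hz => by simp only [hz]))
  rw [apConst_congr hae] at hμK
  rw [hw] at hf ⊢
  obtain ⟨h1, h2, h3⟩ := riesz_bounded_of_measurable hp hα0 hα2 hd2 hDo.measurableSet hdist
    hμ.1.measurable_mk (hμK.trans_lt ENNReal.coe_lt_top) hf
  refine ⟨h1, h2, h3.trans ?_⟩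
  rw [ENNReal.coe_toNNReal (ENNReal.mul_ne_top hS hK)]
  gcongr
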